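/- Let $K$ be a field, $n\ge 3$, and let $G=W(C_n)$ be the whiskered $n$-cycle: its vertices are $x_1,\dots,x_{2n}$ and its edges are the cycle edges $\{x_1,x_2\},\dots,\{x_{n-1},x_n\},\{x_n,x_1\}$ and the whiskers $\{x_i,x_{n+i}\}$ for $1\le i\le n$. Let $I=I(G)=(x_ix_j : \{x_i,x_j\}\in E(G))\subseteq K[x_1,\dots,x_{2n}]$ be its edge ideal, let $s\ge 0$ be an integer (with $I^0=K[x_1,\dots,x_{2n}]$), and let $M$ be a minimal monomial generator of $I^s$. Then $x_n^2\in(I^{s+1}:M)$ if and only if there is an integer $m$ with $1\le m\le s$ such that $n=2m+1$ and $$M=(x_1x_2)(x_3x_4)\cdots(x_{2m-1}x_{2m})\,N\quad\text{for some } N\in I^{s-m}.$$ Moreover, in this case $x_nx_j\in(I^{s+1}:M)$ for all $j=1,\dots,2n$. -/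

import Mathlib

namespace WhiskeredCycle

/-- The graph `W(G)`, obtained from `G` by adding a whisker at each vertex: the old vertices are
`Sum.inl v`, and `Sum.inr v` is the new vertex, joined to `Sum.inl v` only. -/
def whisker {V : Type*} (G : SimpleGraph V) : SimpleGraph (V ⊕ V) where
  Adj a b :=
    match a, b with
    | Sum.inl u, Sum.inl v => G.Adj u v
    | Sum.inl u, Sum.inr v => u = v
    | Sum.inr u, Sum.inl v => u = v
    | Sum.inr _, Sum.inr _ => False
  symm := ⟨by
    rintro (u | u) (v | v) h
    · exact SimpleGraph.Adj.symm h
    · exact Eq.symm h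
    · exact Eq.symm h
    · exact h⟩
  loopless := ⟨by
    rintro (u | u) h
    · exact G.irrefl h
    · exact h⟩

/-- The edge ideal `I(G)` in the polynomial ring over `K` whose variables are the vertices. -/
noncomputable def edgeIdeal (K : Type*) [Field K] {V : Type*} (G : SimpleGraph V) :
    Ideal (MvPolynomial V K) :=
  Ideal.span {p | ∃ u v : V, G.Adj u v ∧ p = MvPolynomial.X u * MvPolynomial.X v}

/-- `M` is a minimal (monomial) generator of the monomial ideal `J`: a monic monomial in `J`
that is minimal with respect to divisibility among the monomials in `J`. -/
def IsMinimalGenerator {K : Type*} [Field K] {V : Type*} (J : Ideal (MvPolynomial V K))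
    (M : MvPolynomial V K) : Prop :=
  ∃ d : V →₀ ℕ, M = MvPolynomial.monomial d 1 ∧ MvPolynomial.monomial d (1 : K) ∈ J ∧
    ∀ d' : V →₀ ℕ, d' ≤ d → MvPolynomial.monomial d' (1 : K) ∈ J → d' = d

/-- The variable `x_{i+1}` (`0 ≤ i < n`) attached to a vertex of the cycle in `W(C_n)`. -/
noncomputable def cycleVar (K : Type*) [Field K] (n i : ℕ) (hi : i < n) :
    MvPolynomial (Fin n ⊕ Fin n) K :=
  MvPolynomial.X (Sum.inl ⟨i, hi⟩)

end WhiskeredCycle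

namespace WhiskeredCycle

open MvPolynomial SimpleGraph

section Counting

variable {n : ℕ} [NeZero n]

/-- `a i` counts the edges `{i, i + 1}` and `d (inr i)` the whiskers at `i` in a factorization of
the monomial with exponent `d` as a product of `s` edges of the whiskered `n`-cycle. -/
def IsEdgeCount (s : ℕ) (d : Fin n ⊕ Fin n →₀ ℕ) (a : Fin n → ℕ) : Prop :=
  (∀ i, d (Sum.inl i) = a i + a (i - 1) + d (Sum.inr i)) ∧ ∑ i, a i + ∑ i, d (Sum.inr i) = s

theorem cycleGraph_adj_iff (hn : 2 ≤ n) (u v : Fin n) :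
    (cycleGraph n).Adj u v ↔ u = v + 1 ∨ v = u + 1 := by
  obtain ⟨k, rfl⟩ := Nat.exists_eq_add_of_le' hn
  rw [cycleGraph_adj, sub_eq_iff_eq_add', sub_eq_iff_eq_add']

theorem IsEdgeCount.degree_eq {s : ℕ} {d : Fin n ⊕ Fin n →₀ ℕ} {a : Fin n → ℕ}
    (h : IsEdgeCount s d a) : d.degree = 2 * s := by
  have hshift : ∑ i, a (i - 1) = ∑ i, a i := (Equiv.subRight (1 : Fin n)).sum_comp a
  rw [Finsupp.degree_eq_sum, Fintype.sum_sum_type, Finset.sum_congr rfl fun i _ => h.1 i,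
    Finset.sum_add_distrib, Finset.sum_add_distrib, hshift, ← h.2]
  ring

theorem IsEdgeCount.add_cycleEdge {s : ℕ} {d : Fin n ⊕ Fin n →₀ ℕ} {a : Fin n → ℕ}
    (h : IsEdgeCount s d a) (i : Fin n) :
    IsEdgeCount (s + 1) (d + (Finsupp.single (Sum.inl i) 1 + Finsupp.single (Sum.inl (i + 1)) 1))
      (a + Pi.single i 1) := by
  refine ⟨fun j => ?_, ?_⟩
  · have h1 : (Pi.single i 1 : Fin n → ℕ) (j - 1) = if i + 1 = j then 1 else 0 := by
      simp only [Pi.single_apply, sub_eq_iff_eq_add, eq_comm (a := j)]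
    have h2 : (Pi.single i 1 : Fin n → ℕ) j = if i = j then 1 else 0 := by
      simp only [Pi.single_apply, eq_comm]
    simp only [Finsupp.add_apply, Pi.add_apply, h1, h2, Finsupp.single_apply, h.1 j,
      Sum.inl.injEq, reduceCtorEq, if_false]
    ring
  · simp [Finset.sum_add_distrib, ← h.2]
    ring

theorem IsEdgeCount.add_whisker {s : ℕ} {d : Fin n ⊕ Fin n →₀ ℕ} {a : Fin n → ℕ}
    (h : IsEdgeCount s d a) (i : Fin n) :
    IsEdgeCount (s + 1) (d + (Finsupp.single (Sum.inl i) 1 + Finsupp.single (Sum.inr i) 1)) a := by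
  refine ⟨fun j => ?_, ?_⟩
  · simp only [Finsupp.add_apply, Finsupp.single_apply, h.1 j,
      Sum.inl.injEq, Sum.inr.injEq, reduceCtorEq, if_false]
    ring
  · simp [Finset.sum_add_distrib, Finsupp.single_apply, ← h.2]
    ring

theorem IsEdgeCount.exists_add_edge {s : ℕ} {d : Fin n ⊕ Fin n →₀ ℕ} {a : Fin n → ℕ}
    (hn : 2 ≤ n) (h : IsEdgeCount s d a) {u v : Fin n ⊕ Fin n}
    (huv : (whisker (cycleGraph n)).Adj u v) :
    ∃ a', IsEdgeCount (s + 1) (d + (Finsupp.single u 1 + Finsupp.single v 1)) a' := by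
  rcases u with u | u <;> rcases v with v | v
  · rcases (cycleGraph_adj_iff hn u v).1 huv with rfl | rfl
    · rw [add_comm (Finsupp.single (Sum.inl (v + 1)) 1)]
      exact ⟨_, h.add_cycleEdge v⟩
    · exact ⟨_, h.add_cycleEdge u⟩
  · obtain rfl : u = v := huv
    exact ⟨_, h.add_whisker u⟩
  · obtain rfl : u = v := huv
    rw [add_comm (Finsupp.single (Sum.inr u) 1)]
    exact ⟨_, h.add_whisker u⟩
  · exact huv.elim

variable (K : Type*) [Field K]

theorem edgeIdeal_pow_le (hn : 2 ≤ n) (s : ℕ) :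
    edgeIdeal K (whisker (cycleGraph n)) ^ s ≤
      Ideal.span ((fun d => monomial d (1 : K)) '' {d | ∃ a, IsEdgeCount s d a}) := by
  induction s with
  | zero =>
    rw [pow_zero, Ideal.one_eq_top, top_le_iff, Ideal.eq_top_iff_one]
    exact Ideal.subset_span ⟨0, ⟨0, by simp [IsEdgeCount]⟩, rfl⟩
  | succ s ih =>
    rw [pow_succ]
    refine (Ideal.mul_mono_left ih).trans ?_
    rw [edgeIdeal, Ideal.span_mul_span', Ideal.span_le]
    rintro _ ⟨_, ⟨d, ⟨a, ha⟩, rfl⟩, _, ⟨u, v, huv, rfl⟩, rfl⟩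
    refine Ideal.subset_span ⟨_, ha.exists_add_edge hn huv, ?_⟩
    simp [X, monomial_mul]

theorem exists_isEdgeCount_of_monomial_mem {K} [Field K] (hn : 2 ≤ n) {s : ℕ}
    {d : Fin n ⊕ Fin n →₀ ℕ}
    (h : monomial d (1 : K) ∈ edgeIdeal K (whisker (cycleGraph n)) ^ s) :
    ∃ d' ≤ d, ∃ a, IsEdgeCount s d' a := by
  obtain ⟨d', ⟨a, ha⟩, hle⟩ := mem_ideal_span_monomial_image.1 (edgeIdeal_pow_le K hn s h) d
    (by simp [mem_support_iff])
  exact ⟨d', hle, a, ha⟩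

theorem X_mul_X_mem_edgeIdeal {V : Type*} {G : SimpleGraph V} {u v : V} (h : G.Adj u v) :
    (X u * X v : MvPolynomial V K) ∈ edgeIdeal K G :=
  Ideal.subset_span ⟨u, v, h, rfl⟩

theorem cycleEdge_mem (hn : 2 ≤ n) (i : Fin n) :
    (X (Sum.inl i) * X (Sum.inl (i + 1)) : MvPolynomial (Fin n ⊕ Fin n) K) ∈
      edgeIdeal K (whisker (cycleGraph n)) :=
  X_mul_X_mem_edgeIdeal K
    (show (cycleGraph n).Adj i (i + 1) from (cycleGraph_adj_iff hn _ _).2 (Or.inr rfl))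

omit [NeZero n] in
theorem whiskerEdge_mem (i : Fin n) :
    (X (Sum.inl i) * X (Sum.inr i) : MvPolynomial (Fin n ⊕ Fin n) K) ∈
      edgeIdeal K (whisker (cycleGraph n)) :=
  X_mul_X_mem_edgeIdeal K rfl

/-- The product of cycle edges with multiplicities `a` and whiskers with multiplicities `b`. -/
noncomputable def edgeProd (a b : Fin n → ℕ) : MvPolynomial (Fin n ⊕ Fin n) K :=
  (∏ i, (X (Sum.inl i) * X (Sum.inl (i + 1))) ^ a i) * ∏ i, (X (Sum.inl i) * X (Sum.inr i)) ^ b i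

theorem edgeProd_mem (hn : 2 ≤ n) (a b : Fin n → ℕ) :
    edgeProd K a b ∈ edgeIdeal K (whisker (cycleGraph n)) ^ (∑ i, a i + ∑ i, b i) := by
  rw [pow_add, ← Finset.prod_pow_eq_pow_sum, ← Finset.prod_pow_eq_pow_sum]
  exact Ideal.mul_mem_mul
    (Ideal.prod_mem_prod fun i _ => Ideal.pow_mem_pow (cycleEdge_mem K hn i) _)
    (Ideal.prod_mem_prod fun i _ => Ideal.pow_mem_pow (whiskerEdge_mem K i) _)

theorem edgeProd_add (a a' b : Fin n → ℕ) :
    edgeProd K (a + a') b =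
      (∏ i, (X (Sum.inl i) * X (Sum.inl (i + 1))) ^ a i) * edgeProd K a' b := by
  simp only [edgeProd, Pi.add_apply, pow_add, Finset.prod_mul_distrib, mul_assoc]

theorem IsEdgeCount.monomial_eq {s : ℕ} {d : Fin n ⊕ Fin n →₀ ℕ} {a : Fin n → ℕ}
    (h : IsEdgeCount s d a) : monomial d (1 : K) = edgeProd K a fun i => d (Sum.inr i) := by
  have hshift : ∏ i, (X (Sum.inl i) : MvPolynomial (Fin n ⊕ Fin n) K) ^ a (i - 1) =
      ∏ i, X (Sum.inl (i + 1)) ^ a i := by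
    rw [← Equiv.prod_comp (Equiv.addRight (1 : Fin n))]
    simp
  rw [MvPolynomial.monomial_eq, C_1, one_mul, Finsupp.prod_fintype _ _ fun _ => pow_zero _,
    Fintype.prod_sum_type, Finset.prod_congr rfl fun i _ => by rw [h.1 i]]
  simp only [edgeProd, pow_add, mul_pow, Finset.prod_mul_distrib, hshift]
  ring

end Counting

@[to_additive]
theorem prod_range_two_mul {α : Type*} [CommMonoid α] (g : ℕ → α) (m : ℕ) :
    ∏ j ∈ Finset.range (2 * m), g j = ∏ k ∈ Finset.range m, g (2 * k) * g (2 * k + 1) := by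
  induction m with
  | zero => simp
  | succ m ih =>
    rw [Nat.mul_succ, Finset.prod_range_succ, Finset.prod_range_succ, ih,
      Finset.prod_range_succ, mul_assoc]

@[to_additive]
theorem prod_fin_odd {α : Type*} [CommMonoid α] (m : ℕ) (f : Fin (2 * m + 1) → α) :
    ∏ i, f i = (∏ k : Fin m, f ⟨2 * k, by omega⟩ * f ⟨2 * k + 1, by omega⟩) *
      f (Fin.last (2 * m)) := by
  rw [Fin.prod_univ_castSucc]
  congr 1
  let g : ℕ → α := fun j => if h : j < 2 * m then f ⟨j, by omega⟩ else 1
  calc ∏ i : Fin (2 * m), f i.castSucc = ∏ i : Fin (2 * m), g i :=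
        Finset.prod_congr rfl fun i _ => by simp [g, Fin.castSucc, Fin.castAdd, Fin.castLE]
    _ = ∏ k ∈ Finset.range m, g (2 * k) * g (2 * k + 1) := by
        rw [← Finset.prod_range, prod_range_two_mul]
    _ = _ := by
        rw [Finset.prod_range]
        refine Finset.prod_congr rfl fun k _ => ?_
        have := k.2
        simp only [g]
        rw [dif_pos (by omega), dif_pos (by omega)]

variable (K : Type*) [Field K]

theorem exists_prod_cycle_eq {m : ℕ} (hm : 1 ≤ m) (i : Fin (2 * m + 1)) :
    ∃ P ∈ edgeIdeal K (whisker (cycleGraph (2 * m + 1))) ^ m,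
      (∏ j, X (Sum.inl j) : MvPolynomial (Fin (2 * m + 1) ⊕ Fin (2 * m + 1)) K) =
        P * X (Sum.inl i) := by
  rw [← Equiv.prod_comp (Equiv.addRight (i + 1)), prod_fin_odd]
  refine ⟨_, ?_, congrArg _ ?_⟩
  · have hpow (J : Ideal (MvPolynomial (Fin (2 * m + 1) ⊕ Fin (2 * m + 1)) K)) :
        J ^ m = ∏ _k : Fin m, J := by simp
    rw [hpow]
    refine Ideal.prod_mem_prod fun k _ => ?_
    have hsucc : (⟨2 * k + 1, by omega⟩ : Fin (2 * m + 1)) = ⟨2 * k, by omega⟩ + 1 := by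
      ext
      rw [Fin.val_add_one_of_lt (by simp [Fin.lt_def, Fin.last])]
    simp only [Equiv.coe_addRight, hsucc]
    rw [add_right_comm _ 1 (i + 1)]
    exact cycleEdge_mem K (by omega) _
  · have hlast : Fin.last (2 * m) + (i + 1) = i := by
      rw [add_left_comm, Fin.last_add_one, add_zero]
    simp only [Equiv.coe_addRight, hlast]

theorem prod_cycle_mul_X_mem {m : ℕ} (hm : 1 ≤ m) (v : Fin (2 * m + 1) ⊕ Fin (2 * m + 1)) :
    (∏ j, X (Sum.inl j)) * X v ∈ edgeIdeal K (whisker (cycleGraph (2 * m + 1))) ^ (m + 1) := by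
  obtain ⟨i, hi⟩ : ∃ i : Fin (2 * m + 1),
      X (Sum.inl i) * X v ∈ edgeIdeal K (whisker (cycleGraph (2 * m + 1))) := by
    rcases v with v | v
    · exact ⟨v + 1, by rw [mul_comm (X _)]; exact cycleEdge_mem K (by omega) v⟩
    · exact ⟨v, whiskerEdge_mem K v⟩
  obtain ⟨P, hP, h⟩ := exists_prod_cycle_eq K hm i
  rw [h, mul_assoc, pow_succ]
  exact Ideal.mul_mem_mul hP hi

/-- A solution of `w i + w (i - 1) = 2 • δ_{n-1}` on the `n`-cycle forces `n` to be odd, and then it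
is `-1` at the even places before the last one. -/
theorem alternating_of_single {n : ℕ} [NeZero n] (hn : 2 ≤ n) (w : Fin n → ℤ)
    (h : ∀ i : Fin n, w i + w (i - 1) = if (i : ℕ) = n - 1 then 2 else 0) :
    ∃ m, n = 2 * m + 1 ∧ ∀ k < m, ∀ hkn : 2 * k < n, w ⟨2 * k, hkn⟩ = -1 := by
  have hsub (j : ℕ) (hj : j + 1 < n) : (⟨j + 1, hj⟩ - 1 : Fin n) = ⟨j, by omega⟩ := by
    rw [sub_eq_iff_eq_add]
    obtain ⟨n, rfl⟩ := Nat.exists_eq_add_of_le' (by omega : 1 ≤ n)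
    ext
    rw [Fin.val_add_one_of_lt (by simp [Fin.lt_def]; omega)]
  have hzero : (⟨0, by omega⟩ - 1 : Fin n) = ⟨n - 1, by omega⟩ := by
    obtain ⟨n, rfl⟩ := Nat.exists_eq_add_of_le' (by omega : 1 ≤ n)
    rw [sub_eq_iff_eq_add]
    exact (Fin.last_add_one n).symm
  set α := w ⟨n - 1, by omega⟩ with hα
  have key (j : ℕ) : ∀ hj : j < n - 1, w ⟨j, by omega⟩ = (-1) ^ (j + 1) * α := by
    induction j with
    | zero =>
      intro hj
      have h0 := h ⟨0, by omega⟩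
      rw [hzero, if_neg (by simp; omega)] at h0
      rw [← hα] at h0
      rw [zero_add, pow_one]
      linarith
    | succ j ih =>
      intro hj
      have h1 := h ⟨j + 1, by omega⟩
      rw [hsub, ih (by omega), if_neg (by simp; omega)] at h1
      rw [pow_succ]
      linarith
  have hlast : α + (-1) ^ (n - 1) * α = 2 := by
    have h1 := h ⟨n - 1, by omega⟩
    have h2 : n - 2 + 1 = n - 1 := by omega
    have h3 := hsub (n - 2) (by omega)
    simp only [h2] at h3
    rw [h3, key (n - 2) (by omega), if_pos rfl, h2] at h1
    exact h1
  rcases Nat.even_or_odd' (n - 1) with ⟨m, hm | hm⟩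
  · refine ⟨m, by omega, fun k hk hkn => ?_⟩
    rw [hm, (even_two_mul m).neg_one_pow] at hlast
    rw [key _ (by omega), (odd_two_mul_add_one k).neg_one_pow]
    linarith
  · rw [hm, (odd_two_mul_add_one m).neg_one_pow] at hlast
    linarith

/-- The indicator function of the perfect matching `{0, 1}, {2, 3}, …` of the path obtained from
the cycle by deleting its last vertex. -/
def matching (m : ℕ) (i : Fin (2 * m + 1)) : ℕ :=
  if Even (i : ℕ) ∧ (i : ℕ) ≠ 2 * m then 1 else 0

theorem prod_matching {α : Type*} [CommMonoid α] (m : ℕ) (f : Fin (2 * m + 1) → α) :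
    ∏ i, f i ^ matching m i = ∏ k : Fin m, f ⟨2 * k, by omega⟩ := by
  rw [prod_fin_odd, matching, if_neg (by simp), pow_zero, mul_one]
  refine Finset.prod_congr rfl fun k _ => ?_
  have := k.2
  rw [matching, matching, if_pos ⟨by simp, by simp; omega⟩, if_neg (by simp),
    pow_one, pow_zero, mul_one]

theorem sum_matching (m : ℕ) : ∑ i, matching m i = m := by
  rw [sum_fin_odd]
  have h (k : Fin m) : (k : ℕ) ≠ m := k.2.ne
  simp [matching, h]

theorem IsMinimalGenerator.exists_matching {n s : ℕ} (hn : 2 < n)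
    {M : MvPolynomial (Fin n ⊕ Fin n) K}
    (hM : IsMinimalGenerator (edgeIdeal K (whisker (cycleGraph n)) ^ s) M)
    (h : cycleVar K n (n - 1) (by omega) ^ 2 * M ∈
      edgeIdeal K (whisker (cycleGraph n)) ^ (s + 1)) :
    ∃ (m : ℕ) (hm : 2 * m + 1 = n), 1 ≤ m ∧ m ≤ s ∧
      ∃ N ∈ edgeIdeal K (whisker (cycleGraph n)) ^ (s - m),
        M = (∏ k : Fin m, cycleVar K n (2 * k) (by omega) *
          cycleVar K n (2 * k + 1) (by omega)) * N := by
  have : NeZero n := ⟨by omega⟩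
  obtain ⟨d, rfl, hd, hmin⟩ := hM
  obtain ⟨d', hle, a, ha⟩ := exists_isEdgeCount_of_monomial_mem (by omega) hd
  obtain rfl : d' = d := hmin d' hle (by
    rw [ha.monomial_eq K, ← ha.2]
    exact edgeProd_mem K (by omega) _ _)
  set e : Fin n ⊕ Fin n →₀ ℕ := Finsupp.single (Sum.inl ⟨n - 1, by omega⟩) 2 with he
  have hmul : cycleVar K n (n - 1) (by omega) ^ 2 * monomial d' (1 : K) =
      monomial (e + d') 1 := by
    rw [cycleVar, X_pow_eq_monomial, monomial_mul, one_mul]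
  rw [hmul] at h
  obtain ⟨c, hc, b, hb⟩ := exists_isEdgeCount_of_monomial_mem (by omega) h
  obtain rfl : c = e + d' := by
    obtain ⟨r, hr⟩ := exists_add_of_le hc
    have hdeg := congrArg Finsupp.degree hr
    simp only [map_add, ha.degree_eq, hb.degree_eq, he, Finsupp.degree_single] at hdeg
    rw [hr, (Finsupp.degree_eq_zero_iff r).1 (by omega), add_zero]
  obtain ⟨m, rfl, hw⟩ := alternating_of_single (by omega) (fun i => (b i : ℤ) - a i) (by
    intro i
    have h1 := ha.1 i
    have h2 := hb.1 i
    simp only [Finsupp.add_apply, he, Finsupp.single_apply, Sum.inl.injEq, reduceCtorEq, if_false,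
      Fin.ext_iff] at h2
    split_ifs at h2 ⊢ <;> omega)
  have hmatch : matching m ≤ a := by
    intro i
    rw [matching]
    split_ifs with hi
    · obtain ⟨⟨k, hk⟩, hne⟩ := hi
      have hlt := i.2
      have h1 := hw k (by omega) (by omega)
      have h2 : (⟨2 * k, by omega⟩ : Fin (2 * m + 1)) = i := Fin.ext (by simp; omega)
      beta_reduce at h1
      rw [h2] at h1
      change (1 : ℕ) ≤ a i
      omega
    · exact Nat.zero_le _
  obtain ⟨a', rfl⟩ := exists_add_of_le hmatch
  have hs := ha.2
  simp only [Pi.add_apply, Finset.sum_add_distrib, sum_matching] at hs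
  refine ⟨m, rfl, by omega, by omega, edgeProd K a' fun i => d' (Sum.inr i), ?_, ?_⟩
  · rw [show s - m = ∑ i, a' i + ∑ i, d' (Sum.inr i) by omega]
    exact edgeProd_mem K (by omega) _ _
  · rw [ha.monomial_eq K, edgeProd_add, prod_matching]
    congr 1
    refine Finset.prod_congr rfl fun k _ => ?_
    rw [cycleVar, cycleVar]
    congr 3
    ext
    rw [Fin.val_add_one_of_lt (by simp [Fin.lt_def])]

theorem cycleVar_mul_X_mul_mem {m s : ℕ} (hm : 1 ≤ m) (hms : m ≤ s)
    {N : MvPolynomial (Fin (2 * m + 1) ⊕ Fin (2 * m + 1)) K}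
    (hN : N ∈ edgeIdeal K (whisker (cycleGraph (2 * m + 1))) ^ (s - m))
    (v : Fin (2 * m + 1) ⊕ Fin (2 * m + 1)) :
    cycleVar K (2 * m + 1) (2 * m + 1 - 1) (by omega) * X v *
        ((∏ k : Fin m, cycleVar K (2 * m + 1) (2 * k) (by omega) *
          cycleVar K (2 * m + 1) (2 * k + 1) (by omega)) * N) ∈
      edgeIdeal K (whisker (cycleGraph (2 * m + 1))) ^ (s + 1) := by
  have h := Ideal.mul_mem_mul (prod_cycle_mul_X_mem K hm v) hN
  rw [prod_fin_odd, ← pow_add, show m + 1 + (s - m) = s + 1 by omega] at h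
  convert h using 1
  simp only [cycleVar, Fin.last, Nat.add_sub_cancel]
  ring

end WhiskeredCycle

/-- The variables `x_1, …, x_n` are `X (Sum.inl 0), …, X (Sum.inl (n-1))`, and
`x_{n+1}, …, x_{2n}` are `X (Sum.inr 0), …, X (Sum.inr (n-1))`. -/
theorem lemma2p3 (K : Type*) [Field K] (n : ℕ) (hn : 3 ≤ n) (s : ℕ)
    (I : Ideal (MvPolynomial (Fin n ⊕ Fin n) K))
    (hI : I = WhiskeredCycle.edgeIdeal K (WhiskeredCycle.whisker (SimpleGraph.cycleGraph n)))
    (M : MvPolynomial (Fin n ⊕ Fin n) K)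
    (hM : WhiskeredCycle.IsMinimalGenerator (I ^ s) M) :
    (WhiskeredCycle.cycleVar K n (n - 1) (by omega) ^ 2 ∈ (I ^ (s + 1)).colon {M} ↔
      ∃ (m : ℕ) (hm : n = 2 * m + 1), 1 ≤ m ∧ m ≤ s ∧ ∃ N ∈ I ^ (s - m),
        M = (∏ k : Fin m, WhiskeredCycle.cycleVar K n (2 * k) (by omega) *
          WhiskeredCycle.cycleVar K n (2 * k + 1) (by omega)) * N) ∧
    (WhiskeredCycle.cycleVar K n (n - 1) (by omega) ^ 2 ∈ (I ^ (s + 1)).colon {M} →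
      ∀ v : Fin n ⊕ Fin n,
        WhiskeredCycle.cycleVar K n (n - 1) (by omega) * MvPolynomial.X v ∈
          (I ^ (s + 1)).colon {M}) := by
  subst hI
  simp only [Submodule.mem_colon_singleton, smul_eq_mul]
  have hback : (∃ (m : ℕ) (hm : n = 2 * m + 1), 1 ≤ m ∧ m ≤ s ∧
      ∃ N ∈ WhiskeredCycle.edgeIdeal K
        (WhiskeredCycle.whisker (SimpleGraph.cycleGraph n)) ^ (s - m),
      M = (∏ k : Fin m, WhiskeredCycle.cycleVar K n (2 * k) (by omega) *
        WhiskeredCycle.cycleVar K n (2 * k + 1) (by omega)) * N) →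
      ∀ v : Fin n ⊕ Fin n,
        WhiskeredCycle.cycleVar K n (n - 1) (by omega) * MvPolynomial.X v * M ∈
          WhiskeredCycle.edgeIdeal K
            (WhiskeredCycle.whisker (SimpleGraph.cycleGraph n)) ^ (s + 1) := by
    rintro ⟨m, rfl, hm, hms, N, hN, rfl⟩ v
    exact WhiskeredCycle.cycleVar_mul_X_mul_mem K hm hms hN v
  refine ⟨⟨fun h => ?_, fun h => ?_⟩, fun h => hback ?_⟩
  · obtain ⟨m, hm, h⟩ := hM.exists_matching K hn h
    exact ⟨m, hm.symm, h⟩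
  · rw [sq]
    exact hback h _
  · obtain ⟨m, hm, h⟩ := hM.exists_matching K hn h
    exact ⟨m, hm.symm, h⟩
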